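/- All abelian varieties are over $\mathbb C$. For an abelian variety $A$, let $G(A)\subset GL(H^1(A,\mathbb Q))$ be its Hodge group, i.e. the smallest $\mathbb Q$-algebraic subgroup of $GL(H^1(A,\mathbb Q))$ whose real points contain the image of the homomorphism $U(1)\to GL(H^1(A,\mathbb R))$ under which $z$ acts on $H^{1,0}(A)$ as $z$ and on $H^{0,1}(A)$ as $\bar z$. It acts on $H^\star(A,\mathbb C)=\bigwedge^\star H^1(A,\mathbb C)$, and $G(A\times B)$ is a subgroup of $G(A)\times G(B)$ inside $GL(H^1(A\times B,\mathbb Q))$, where $H^1(A\times B,\mathbb Q)=H^1(A,\mathbb Q)\oplus H^1(B,\mathbb Q)$. For a class $\mathcal A$ of abelian varieties, we say that $A$ is *$\mathbb C$-dominated* by $\mathcal A$ if, for every irreducible $G(A)_{\mathbb C}$-submodule $V$ of $H^\star(A,\mathbb C)$, there exist $B\in\mathcal A$, an integer $n\ge 0$ and a $G(B)_{\mathbb C}$-submodule $V'$ of $H^n(B,\mathbb C)$ such that $V$ and $V'$ are isomorphic as $G(A\times B)_{\mathbb C}$-modules and $V'$ contains a nonzero $(n,0)$-form. **Proposition.** Let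 $A$ and $B$ be abelian varieties such that $G(A\times B)=G(A)\times G(B)$. If $A$ is $\mathbb C$-dominated by $\mathcal A$ and $B$ is $\mathbb C$-dominated by $\mathcal B$, then $A\times B$ is $\mathbb C$-dominated by $\mathcal A\cdot\mathcal B=\{\,X\times Y\mid X\in\mathcal A,\ Y\in\mathcal B\,\}$. -/

import Mathlib

universe u

noncomputable section

/-- A complex abelian variety `E / lattice`: a finite-dimensional complex vector space `E` (the Lie
algebra), a full lattice in `E` (a subgroup generated by a real basis of `E`), and the existence
of a Riemann form, i.e. a polarization. -/
structure ComplexAbelianVariety : Type (u + 1) where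
  E : Type u
  [addCommGroup : AddCommGroup E]
  [module : Module ℂ E]
  [finiteDimensional : FiniteDimensional ℂ E]
  lattice : AddSubgroup E
  isLattice : ∃ (n : ℕ) (b : Module.Basis (Fin n) ℝ E),
    lattice = AddSubgroup.closure (Set.range b)
  exists_riemannForm : ∃ ω : E →ₗ[ℝ] E →ₗ[ℝ] ℝ,
    (∀ x, ω x x = 0) ∧
    (∀ x y, ω (Complex.I • x) (Complex.I • y) = ω x y) ∧
    (∀ x, x ≠ 0 → 0 < ω x (Complex.I • x)) ∧
    (∀ x ∈ lattice, ∀ y ∈ lattice, ∃ m : ℤ, ω x y = m)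

namespace ComplexAbelianVariety

attribute [instance] addCommGroup module finiteDimensional

/-- The product of two abelian varieties: `(E₁ × E₂) / (Λ₁ × Λ₂)`. -/
def prod (A B : ComplexAbelianVariety.{u}) : ComplexAbelianVariety.{u} where
  E := A.E × B.E
  lattice := A.lattice.prod B.lattice
  isLattice := by
    obtain ⟨n, b, hb⟩ := A.isLattice
    obtain ⟨m, c, hc⟩ := B.isLattice
    refine ⟨n + m, (b.prod c).reindex finSumFinEquiv, ?_⟩
    rw [Module.Basis.range_reindex]
    apply le_antisymm
    · rintro ⟨x, y⟩ hxy
      obtain ⟨hx, hy⟩ := AddSubgroup.mem_prod.1 hxy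
      have h1 : ((x, 0) : A.E × B.E) ∈ AddSubgroup.closure (Set.range (b.prod c)) := by
        have : A.lattice ≤ (AddSubgroup.closure (Set.range (b.prod c))).comap
            (AddMonoidHom.inl A.E B.E) := by
          rw [hb, AddSubgroup.closure_le]
          rintro _ ⟨i, rfl⟩
          exact AddSubgroup.subset_closure ⟨Sum.inl i, by ext <;> simp⟩
        exact this hx
      have h2 : ((0, y) : A.E × B.E) ∈ AddSubgroup.closure (Set.range (b.prod c)) := by
        have : B.lattice ≤ (AddSubgroup.closure (Set.range (b.prod c))).comap
            (AddMonoidHom.inr A.E B.E) := by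
          rw [hc, AddSubgroup.closure_le]
          rintro _ ⟨i, rfl⟩
          exact AddSubgroup.subset_closure ⟨Sum.inr i, by ext <;> simp⟩
        exact this hy
      simpa using add_mem h1 h2
    · rw [AddSubgroup.closure_le]
      rintro _ ⟨i | i, rfl⟩
      · refine AddSubgroup.mem_prod.2 ⟨?_, ?_⟩
        · rw [hb]; exact AddSubgroup.subset_closure ⟨i, by simp⟩
        · simp
      · refine AddSubgroup.mem_prod.2 ⟨?_, ?_⟩
        · simp
        · rw [hc]; exact AddSubgroup.subset_closure ⟨i, by simp⟩
  exists_riemannForm := by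
    obtain ⟨ω, h1, h2, h3, h4⟩ := A.exists_riemannForm
    obtain ⟨η, k1, k2, k3, k4⟩ := B.exists_riemannForm
    refine ⟨ω.compl₁₂ (LinearMap.fst ℝ A.E B.E) (LinearMap.fst ℝ A.E B.E) +
      η.compl₁₂ (LinearMap.snd ℝ A.E B.E) (LinearMap.snd ℝ A.E B.E), ?_, ?_, ?_, ?_⟩
    · intro x; simp [h1, k1]
    · intro x y; simp [h2, k2]
    · rintro ⟨x, y⟩ hxy
      have hx : 0 ≤ ω x (Complex.I • x) := by
        rcases eq_or_ne x 0 with rfl | h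
        · simp
        · exact (h3 x h).le
      have hy : 0 ≤ η y (Complex.I • y) := by
        rcases eq_or_ne y 0 with rfl | h
        · simp
        · exact (k3 y h).le
      have : 0 < ω x (Complex.I • x) + η y (Complex.I • y) := by
        rcases eq_or_ne x 0 with rfl | h
        · have hy0 : y ≠ 0 := by rintro rfl; exact hxy rfl
          have := k3 y hy0
          linarith
        · have := h3 x h
          linarith
      simpa using this
    · rintro ⟨x, y⟩ hx ⟨x', y'⟩ hx'
      obtain ⟨m, hm⟩ := h4 x (AddSubgroup.mem_prod.1 hx).1 x' (AddSubgroup.mem_prod.1 hx').1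
      obtain ⟨n, hn⟩ := k4 y (AddSubgroup.mem_prod.1 hx).2 y' (AddSubgroup.mem_prod.1 hx').2
      exact ⟨m + n, by simp [hm, hn]⟩

/-- `H¹(A, ℂ) = Hom(Λ, ℂ) = Hom_ℝ(E, ℂ)`: a class is represented by its unique
translation-invariant 1-form, and its periods are the values on the lattice `Λ = H₁(A, ℤ)`. -/
abbrev H1 (A : ComplexAbelianVariety.{u}) : Type u := A.E →ₗ[ℝ] ℂ

/-- `H¹(A, ℚ)` inside `H¹(A, ℂ)`: the classes with rational periods. -/
def rationalClasses (A : ComplexAbelianVariety.{u}) : Set A.H1 :=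
  {φ | ∀ x ∈ A.lattice, ∃ q : ℚ, φ x = q}

/-- The summand `H^{1,0}(A)` of `H¹(A, ℂ)`: the complex-linear functionals, i.e. the holomorphic
invariant 1-forms. -/
def H10 (A : ComplexAbelianVariety.{u}) : Submodule ℂ A.H1 where
  carrier := {φ | ∀ x, φ (Complex.I • x) = Complex.I * φ x}
  add_mem' := by
    intro φ ψ hφ hψ x
    have h1 := hφ x
    have h2 := hψ x
    simp only [LinearMap.add_apply, h1, h2, mul_add]
  zero_mem' := by intro x; simp
  smul_mem' := by
    intro c φ hφ x
    have h1 := hφ x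
    simp only [LinearMap.smul_apply, h1, smul_eq_mul]
    ring

/-- The cohomology algebra `H^⋆(A, ℂ)`, the exterior algebra on `H¹(A, ℂ)` (cup product);
`Hⁿ(A, ℂ)` is its degree `n` part `⋀[ℂ]^n A.H1`. -/
abbrev Cohomology (A : ComplexAbelianVariety.{u}) : Type u := ExteriorAlgebra ℂ A.H1

/-- `Hⁿ(A, ℂ)` inside `H^⋆(A, ℂ)`. -/
abbrev H (A : ComplexAbelianVariety.{u}) (n : ℕ) : Submodule ℂ A.Cohomology := ⋀[ℂ]^n A.H1

/-- The `(n,0)`-forms `H^{n,0}(A) = ⋀ⁿ H^{1,0}(A)` inside `H^⋆(A, ℂ)`: the span of all products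
of `n` elements of `H^{1,0}(A)`. -/
def formsN0 (A : ComplexAbelianVariety.{u}) (n : ℕ) : Submodule ℂ A.Cohomology :=
  (A.H10.map (ExteriorAlgebra.ι ℂ)) ^ n

/-- `GL(H¹(A, ℂ))`. -/
abbrev GL1 (A : ComplexAbelianVariety.{u}) : Type u := A.H1 ≃ₗ[ℂ] A.H1

/-- `S ⊆ GL(H¹(A, ℂ))` is the set of complex points of a Zariski closed subset of the
`ℚ`-variety `GL(H¹(A, ℚ))`: it is the common zero locus of a set of polynomials with rational
coefficients in the rational matrix coefficients `g ↦ (g φ)(x)`, where `φ ∈ H¹(A, ℚ)` and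
`x ∈ H₁(A, ℤ)`. -/
def IsQClosed (A : ComplexAbelianVariety.{u}) (S : Set A.GL1) : Prop :=
  ∃ P : Set (MvPolynomial (A.rationalClasses × A.lattice) ℚ),
    S = {g | ∀ p ∈ P, MvPolynomial.aeval
      (fun i : A.rationalClasses × A.lattice => (g (i.1 : A.H1)) (i.2 : A.E)) p = 0}

/-- The action of `z ∈ U(1)` on `H¹(A, ℂ)` defining the Hodge structure: multiplication by `z`
on `H^{1,0}` and by the conjugate of `z` on `H^{0,1}`, i.e. `φ ↦ φ(z ·)`. -/
def hodgeCocharacter (A : ComplexAbelianVariety.{u}) (z : Circle) : A.GL1 where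
  toFun φ := φ.comp ((LinearMap.lsmul ℂ A.E (z : ℂ)).restrictScalars ℝ)
  invFun φ := φ.comp ((LinearMap.lsmul ℂ A.E (z : ℂ)⁻¹).restrictScalars ℝ)
  map_add' φ ψ := by ext; simp
  map_smul' c φ := by ext; simp
  left_inv φ := by ext x; simp [smul_smul]
  right_inv φ := by ext x; simp [smul_smul]

/-- The group of complex points of the Hodge group (special Mumford–Tate group) `G(A)`:
the smallest algebraic subgroup of `GL(H¹(A, ℚ))` defined over `ℚ` that contains the image
of `U(1)`. -/
def hodgeGroup (A : ComplexAbelianVariety.{u}) : Subgroup A.GL1 :=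
  sInf {K | A.IsQClosed (K : Set A.GL1) ∧ ∀ z, A.hodgeCocharacter z ∈ K}

/-- The action of `G(A)` on `H^⋆(A, ℂ)` by algebra automorphisms, extending the one on `H¹`. -/
def cohomologyRep (A : ComplexAbelianVariety.{u}) :
    Representation ℂ A.hodgeGroup A.Cohomology where
  toFun g := (ExteriorAlgebra.map ((g : A.GL1) : A.H1 →ₗ[ℂ] A.H1)).toLinearMap
  map_one' := by
    have h : (((1 : A.hodgeGroup) : A.GL1) : A.H1 →ₗ[ℂ] A.H1) = LinearMap.id := rfl
    rw [h, ExteriorAlgebra.map_id]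
    rfl
  map_mul' g h := by
    have e : (((g * h : A.hodgeGroup) : A.GL1) : A.H1 →ₗ[ℂ] A.H1) =
        ((g : A.GL1) : A.H1 →ₗ[ℂ] A.H1) ∘ₗ ((h : A.GL1) : A.H1 →ₗ[ℂ] A.H1) := rfl
    rw [e, ← ExteriorAlgebra.map_comp_map]
    rfl

section Product

variable (A B : ComplexAbelianVariety.{u})

/-- `H¹(A, ℂ) ⊕ H¹(B, ℂ) = H¹(A × B, ℂ)`, `(φ, ψ) ↦ pr₁^* φ + pr₂^* ψ`. -/
def kunneth1 : (A.H1 × B.H1) ≃ₗ[ℂ] (A.prod B).H1 :=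
  LinearMap.coprodEquiv (R := ℝ) (M := A.E) (M₂ := B.E) (M₃ := ℂ) ℂ

/-- The block-diagonal embedding `GL(H¹(A)) × GL(H¹(B)) → GL(H¹(A × B))`. -/
def blockDiag : A.GL1 × B.GL1 →* (A.prod B).GL1 where
  toFun g := ((kunneth1 A B).symm.trans (g.1.prodCongr g.2)).trans (kunneth1 A B)
  map_one' := by
    apply LinearEquiv.ext
    intro φ
    exact (kunneth1 A B).apply_symm_apply φ
  map_mul' g h := by
    apply LinearEquiv.ext
    intro φ
    change _ = kunneth1 A B ((g.1.prodCongr g.2) ((kunneth1 A B).symm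
      (kunneth1 A B ((h.1.prodCongr h.2) ((kunneth1 A B).symm φ)))))
    rw [LinearEquiv.symm_apply_apply]
    rfl

lemma blockDiag_apply (g : A.GL1 × B.GL1) (φ : A.H1) (ψ : B.H1) :
    blockDiag A B g (kunneth1 A B (φ, ψ)) = kunneth1 A B (g.1 φ, g.2 ψ) := by
  change kunneth1 A B ((g.1.prodCongr g.2) ((kunneth1 A B).symm _)) = _
  rw [LinearEquiv.symm_apply_apply]
  rfl

lemma kunneth1_apply (φ : A.H1) (ψ : B.H1) (x : A.E) (y : B.E) :
    kunneth1 A B (φ, ψ) ((x, y) : A.E × B.E) = φ x + ψ y := rfl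

lemma blockDiag_injective : Function.Injective (blockDiag A B) := by
  intro g h e
  have key : ∀ φ ψ, (g.1 φ, g.2 ψ) = (h.1 φ, h.2 ψ) := by
    intro φ ψ
    apply (kunneth1 A B).injective
    rw [← blockDiag_apply, ← blockDiag_apply, e]
  apply Prod.ext
  · exact LinearEquiv.ext fun φ => (Prod.ext_iff.1 (key φ 0)).1
  · exact LinearEquiv.ext fun ψ => (Prod.ext_iff.1 (key 0 ψ)).2

/-- `G(A) × G(B)` as a subgroup of `GL(H¹(A × B, ℂ))`. -/
def hodgeGroupProd : Subgroup (A.prod B).GL1 :=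
  (A.hodgeGroup.prod B.hodgeGroup).map (blockDiag A B)

/-- The rational classes span `H¹(A, ℂ)` over `ℂ`. -/
lemma span_rationalClasses : Submodule.span ℂ A.rationalClasses = ⊤ := by
  obtain ⟨n, b, hb⟩ := A.isLattice
  rw [eq_top_iff]
  intro φ _
  have hφ : φ = ∑ i, φ (b i) • (Complex.ofRealAm.toLinearMap ∘ₗ b.coord i : A.H1) := by
    apply b.ext
    intro j
    simp only [LinearMap.sum_apply, LinearMap.smul_apply, LinearMap.comp_apply,
      Module.Basis.coord_apply, Module.Basis.repr_self, Finsupp.single_apply]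
    simp
  rw [hφ]
  refine Submodule.sum_mem _ fun i _ => Submodule.smul_mem _ _ (Submodule.subset_span ?_)
  intro x hx
  rw [hb] at hx
  induction hx using AddSubgroup.closure_induction with
  | mem x hx =>
    obtain ⟨j, rfl⟩ := hx
    by_cases h : j = i
    · exact ⟨1, by simp [h]⟩
    · exact ⟨0, by simp [h]⟩
  | zero => exact ⟨0, by simp⟩
  | add x y _ _ h1 h2 =>
    obtain ⟨p, hp⟩ := h1
    obtain ⟨q, hq⟩ := h2
    exact ⟨p + q, by rw [map_add, hp, hq]; push_cast; rfl⟩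
  | neg x _ h1 =>
    obtain ⟨p, hp⟩ := h1
    exact ⟨-p, by rw [map_neg, hp]; push_cast; rfl⟩

/-- A class with zero periods is zero. -/
lemma eq_zero_of_periods (φ : A.H1) (h : ∀ x ∈ A.lattice, φ x = 0) : φ = 0 := by
  obtain ⟨n, b, hb⟩ := A.isLattice
  apply b.ext
  intro i
  rw [h (b i) (by rw [hb]; exact AddSubgroup.subset_closure ⟨i, rfl⟩)]
  rfl

/-- `G(A × B)` is a subgroup of `G(A) × G(B)`. -/
theorem hodgeGroup_prod_le : (A.prod B).hodgeGroup ≤ hodgeGroupProd A B := by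
  have main : ∀ (K : Subgroup A.GL1) (L : Subgroup B.GL1), A.IsQClosed (K : Set A.GL1) →
      (∀ z, A.hodgeCocharacter z ∈ K) → B.IsQClosed (L : Set B.GL1) →
      (∀ z, B.hodgeCocharacter z ∈ L) →
      (A.prod B).hodgeGroup ≤ (K.prod L).map (blockDiag A B) := by
    rintro K L ⟨P, hP⟩ hK ⟨Q, hQ⟩ hL
    refine sInf_le ⟨?_, ?_⟩
    · have m1 : ∀ φ : A.rationalClasses,
          kunneth1 A B ((φ : A.H1), 0) ∈ (A.prod B).rationalClasses := by
        rintro ⟨φ, hφ⟩ ⟨x, y⟩ hx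
        obtain ⟨q, hq⟩ := hφ x (AddSubgroup.mem_prod.1 hx).1
        exact ⟨q, by rw [kunneth1_apply]; simpa using hq⟩
      have m2 : ∀ φ : B.rationalClasses,
          kunneth1 A B (0, (φ : B.H1)) ∈ (A.prod B).rationalClasses := by
        rintro ⟨φ, hφ⟩ ⟨x, y⟩ hx
        obtain ⟨q, hq⟩ := hφ y (AddSubgroup.mem_prod.1 hx).2
        exact ⟨q, by rw [kunneth1_apply]; simpa using hq⟩
      have l1 : ∀ x : A.lattice, (((x : A.E), 0) : A.E × B.E) ∈ (A.prod B).lattice :=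
        fun x => AddSubgroup.mem_prod.2 ⟨x.2, zero_mem _⟩
      have l2 : ∀ x : B.lattice, ((0, (x : B.E)) : A.E × B.E) ∈ (A.prod B).lattice :=
        fun x => AddSubgroup.mem_prod.2 ⟨zero_mem _, x.2⟩
      let f11 : A.rationalClasses × A.lattice →
          (A.prod B).rationalClasses × (A.prod B).lattice :=
        fun i => (⟨_, m1 i.1⟩, ⟨_, l1 i.2⟩)
      let f22 : B.rationalClasses × B.lattice →
          (A.prod B).rationalClasses × (A.prod B).lattice :=
        fun i => (⟨_, m2 i.1⟩, ⟨_, l2 i.2⟩)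
      let f12 : A.rationalClasses × B.lattice →
          (A.prod B).rationalClasses × (A.prod B).lattice :=
        fun i => (⟨_, m1 i.1⟩, ⟨_, l2 i.2⟩)
      let f21 : B.rationalClasses × A.lattice →
          (A.prod B).rationalClasses × (A.prod B).lattice :=
        fun i => (⟨_, m2 i.1⟩, ⟨_, l1 i.2⟩)
      refine ⟨(Set.range fun i => MvPolynomial.X (f12 i)) ∪
        (Set.range fun i => MvPolynomial.X (f21 i)) ∪
        (MvPolynomial.rename f11 '' P) ∪ (MvPolynomial.rename f22 '' Q), ?_⟩
      have e11 : ∀ (a : A.GL1) (b : B.GL1) (g : (A.prod B).GL1),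
          (∀ φ ψ, g (kunneth1 A B (φ, ψ)) = kunneth1 A B (a φ, b ψ)) →
          (fun i : (A.prod B).rationalClasses × (A.prod B).lattice =>
            (g (i.1 : (A.prod B).H1)) (i.2 : (A.prod B).E)) ∘ f11 =
          fun i => (a (i.1 : A.H1)) (i.2 : A.E) := by
        intro a b g hg
        funext i
        change (g (kunneth1 A B ((i.1 : A.H1), 0))) (((i.2 : A.E), 0) : A.E × B.E) = _
        rw [hg, kunneth1_apply]
        simp
      have e22 : ∀ (a : A.GL1) (b : B.GL1) (g : (A.prod B).GL1),
          (∀ φ ψ, g (kunneth1 A B (φ, ψ)) = kunneth1 A B (a φ, b ψ)) →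
          (fun i : (A.prod B).rationalClasses × (A.prod B).lattice =>
            (g (i.1 : (A.prod B).H1)) (i.2 : (A.prod B).E)) ∘ f22 =
          fun i => (b (i.1 : B.H1)) (i.2 : B.E) := by
        intro a b g hg
        funext i
        change (g (kunneth1 A B (0, (i.1 : B.H1)))) ((0, (i.2 : B.E)) : A.E × B.E) = _
        rw [hg, kunneth1_apply]
        simp
      apply Set.Subset.antisymm
      · rintro _ ⟨⟨a, b⟩, ⟨ha, hb⟩, rfl⟩ p hp
        have hg := blockDiag_apply A B (a, b)
        rcases hp with ((⟨i, rfl⟩ | ⟨i, rfl⟩) | ⟨p, hp, rfl⟩) | ⟨p, hp, rfl⟩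
        · rw [MvPolynomial.aeval_X]
          change (blockDiag A B (a, b) (kunneth1 A B ((i.1 : A.H1), 0)))
            ((0, (i.2 : B.E)) : A.E × B.E) = _
          rw [hg, kunneth1_apply]
          simp
        · rw [MvPolynomial.aeval_X]
          change (blockDiag A B (a, b) (kunneth1 A B (0, (i.1 : B.H1))))
            (((i.2 : A.E), 0) : A.E × B.E) = _
          rw [hg, kunneth1_apply]
          simp
        · rw [MvPolynomial.aeval_rename, e11 a b _ hg]
          change a ∈ (K : Set A.GL1) at ha
          rw [hP] at ha
          exact ha p hp
        · rw [MvPolynomial.aeval_rename, e22 a b _ hg]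
          change b ∈ (L : Set B.GL1) at hb
          rw [hQ] at hb
          exact hb p hp
      · intro g hg
        let k := kunneth1 A B
        let T : (A.H1 × B.H1) ≃ₗ[ℂ] (A.H1 × B.H1) := (k.trans g).trans k.symm
        have hT : ∀ φ ψ, g (k (φ, ψ)) = k (T (φ, ψ)) := fun φ ψ =>
          (k.apply_symm_apply _).symm
        have z1 : ∀ φ : A.H1, (T (φ, 0)).2 = 0 := by
          have : (⊤ : Submodule ℂ A.H1) ≤ LinearMap.ker
              (LinearMap.snd ℂ A.H1 B.H1 ∘ₗ T.toLinearMap ∘ₗ LinearMap.inl ℂ A.H1 B.H1) := by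
            rw [← span_rationalClasses, Submodule.span_le]
            intro φ hφ
            apply eq_zero_of_periods
            intro y hy
            have := hg (MvPolynomial.X (f12 (⟨φ, hφ⟩, ⟨y, hy⟩)))
              (Or.inl (Or.inl (Or.inl ⟨_, rfl⟩)))
            rw [MvPolynomial.aeval_X] at this
            change (g (k (φ, 0))) ((0, y) : A.E × B.E) = 0 at this
            rw [hT] at this
            change (T (φ, 0)).1 0 + (T (φ, 0)).2 y = 0 at this
            simpa using this
          exact fun φ => this (Submodule.mem_top (x := φ))
        have z2 : ∀ ψ : B.H1, (T (0, ψ)).1 = 0 := by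
          have : (⊤ : Submodule ℂ B.H1) ≤ LinearMap.ker
              (LinearMap.fst ℂ A.H1 B.H1 ∘ₗ T.toLinearMap ∘ₗ LinearMap.inr ℂ A.H1 B.H1) := by
            rw [← span_rationalClasses, Submodule.span_le]
            intro φ hφ
            apply eq_zero_of_periods
            intro y hy
            have := hg (MvPolynomial.X (f21 (⟨φ, hφ⟩, ⟨y, hy⟩)))
              (Or.inl (Or.inl (Or.inr ⟨_, rfl⟩)))
            rw [MvPolynomial.aeval_X] at this
            change (g (k (0, φ))) ((y, 0) : A.E × B.E) = 0 at this
            rw [hT] at this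
            change (T (0, φ)).1 y + (T (0, φ)).2 0 = 0 at this
            simpa using this
          exact fun φ => this (Submodule.mem_top (x := φ))
        have split : ∀ φ ψ, T (φ, ψ) = ((T (φ, 0)).1, (T (0, ψ)).2) := by
          intro φ ψ
          have : ((φ, ψ) : A.H1 × B.H1) = (φ, 0) + (0, ψ) := by simp
          rw [this, map_add]
          apply Prod.ext
          · simp [z2]
          · simp [z1]
        have ba : Function.Bijective
            (LinearMap.fst ℂ A.H1 B.H1 ∘ₗ T.toLinearMap ∘ₗ LinearMap.inl ℂ A.H1 B.H1) := by
          constructor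
          · rw [injective_iff_map_eq_zero]
            intro φ hφ
            have : T (φ, 0) = 0 := Prod.ext hφ (z1 φ)
            exact (Prod.ext_iff.1 ((map_eq_zero_iff T T.injective).1 this)).1
          · intro φ
            obtain ⟨⟨u, v⟩, huv⟩ := T.surjective (φ, 0)
            rw [split] at huv
            exact ⟨u, (Prod.ext_iff.1 huv).1⟩
        have bb : Function.Bijective
            (LinearMap.snd ℂ A.H1 B.H1 ∘ₗ T.toLinearMap ∘ₗ LinearMap.inr ℂ A.H1 B.H1) := by
          constructor
          · rw [injective_iff_map_eq_zero]
            intro φ hφ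
            have : T (0, φ) = 0 := Prod.ext (z2 φ) hφ
            exact (Prod.ext_iff.1 ((map_eq_zero_iff T T.injective).1 this)).2
          · intro φ
            obtain ⟨⟨u, v⟩, huv⟩ := T.surjective (0, φ)
            rw [split] at huv
            exact ⟨v, (Prod.ext_iff.1 huv).2⟩
        let a : A.GL1 := LinearEquiv.ofBijective _ ba
        let b : B.GL1 := LinearEquiv.ofBijective _ bb
        have hab : ∀ φ ψ, g (kunneth1 A B (φ, ψ)) = kunneth1 A B (a φ, b ψ) := by
          intro φ ψ
          rw [hT, split]
          rfl
        refine ⟨(a, b), ⟨?_, ?_⟩, ?_⟩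
        · change a ∈ (K : Set A.GL1)
          rw [hP]
          intro p hp
          have := hg (MvPolynomial.rename f11 p) (Or.inl (Or.inr ⟨p, hp, rfl⟩))
          rwa [MvPolynomial.aeval_rename, e11 a b g hab] at this
        · change b ∈ (L : Set B.GL1)
          rw [hQ]
          intro p hp
          have := hg (MvPolynomial.rename f22 p) (Or.inr ⟨p, hp, rfl⟩)
          rwa [MvPolynomial.aeval_rename, e22 a b g hab] at this
        · apply LinearEquiv.ext
          intro θ
          obtain ⟨⟨φ, ψ⟩, rfl⟩ := (kunneth1 A B).surjective θ
          rw [blockDiag_apply, hab]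
    · intro z
      refine ⟨(A.hodgeCocharacter z, B.hodgeCocharacter z), ⟨hK z, hL z⟩, ?_⟩
      apply LinearEquiv.ext
      intro θ
      obtain ⟨⟨φ, ψ⟩, rfl⟩ := (kunneth1 A B).surjective θ
      rw [blockDiag_apply]
      rfl
  have top1 : A.IsQClosed ((⊤ : Subgroup A.GL1) : Set A.GL1) := ⟨∅, by ext; simp⟩
  have top2 : B.IsQClosed ((⊤ : Subgroup B.GL1) : Set B.GL1) := ⟨∅, by ext; simp⟩
  intro g hg
  obtain ⟨⟨a, b⟩, -, rfl⟩ := main ⊤ ⊤ top1 (fun _ => trivial) top2 (fun _ => trivial) hg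
  refine ⟨(a, b), ⟨?_, ?_⟩, rfl⟩
  · refine Subgroup.mem_sInf.2 ?_
    rintro K ⟨hK, hz⟩
    obtain ⟨c, hc, h⟩ := main K ⊤ hK hz top2 (fun _ => trivial) hg
    rw [blockDiag_injective A B h] at hc
    exact hc.1
  · refine Subgroup.mem_sInf.2 ?_
    rintro L ⟨hL, hz⟩
    obtain ⟨c, hc, h⟩ := main ⊤ L top1 (fun _ => trivial) hL hz hg
    rw [blockDiag_injective A B h] at hc
    exact hc.2

/-- The inclusion `G(A × B) → G(A) × G(B)`. -/
def hodgeGroupInclusion : (A.prod B).hodgeGroup →* A.hodgeGroup × B.hodgeGroup :=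
  (Subgroup.prodEquiv A.hodgeGroup B.hodgeGroup).toMonoidHom.comp
    (((A.hodgeGroup.prod B.hodgeGroup).equivMapOfInjective (blockDiag A B)
      (blockDiag_injective A B)).symm.toMonoidHom.comp
      (Subgroup.inclusion (hodgeGroup_prod_le A B)))

/-- The projection `G(A × B) → G(A)`. -/
def hodgeGroupFst : (A.prod B).hodgeGroup →* A.hodgeGroup :=
  (MonoidHom.fst _ _).comp (hodgeGroupInclusion A B)

/-- The projection `G(A × B) → G(B)`. -/
def hodgeGroupSnd : (A.prod B).hodgeGroup →* B.hodgeGroup :=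
  (MonoidHom.snd _ _).comp (hodgeGroupInclusion A B)

/-- Every `g ∈ G(A × B)` is block diagonal, with blocks its two projections. -/
lemma blockDiag_fst_snd (g : (A.prod B).hodgeGroup) :
    blockDiag A B ((hodgeGroupFst A B g : A.GL1), (hodgeGroupSnd A B g : B.GL1)) = g := by
  have := ((A.hodgeGroup.prod B.hodgeGroup).equivMapOfInjective (blockDiag A B)
      (blockDiag_injective A B)).apply_symm_apply
      (Subgroup.inclusion (hodgeGroup_prod_le A B) g)
  exact congrArg Subtype.val this

end Product

/-- `A` is `ℂ`-dominated by the class `𝒜`: for every irreducible `G(A)`-submodule `V` of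
`H^⋆(A, ℂ)` there are `B ∈ 𝒜`, an integer `n` and a `G(B)`-submodule `V'` of `Hⁿ(B, ℂ)` that is
isomorphic to `V` as a `G(A × B)`-module and contains a nonzero `(n,0)`-form. -/
def IsCDominated (A : ComplexAbelianVariety.{u}) (𝒜 : Set ComplexAbelianVariety.{u}) : Prop :=
  ∀ V : Subrepresentation A.cohomologyRep, V.toRepresentation.IsIrreducible →
    ∃ B ∈ 𝒜, ∃ (n : ℕ) (V' : Subrepresentation B.cohomologyRep),
      V'.toSubmodule ≤ B.H n ∧
      Nonempty (Representation.Equiv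
        (V.toRepresentation.comp (hodgeGroupFst A B))
        (V'.toRepresentation.comp (hodgeGroupSnd A B))) ∧
      ∃ ω ∈ V'.toSubmodule, ω ≠ 0 ∧ ω ∈ B.formsN0 n

end ComplexAbelianVariety

end

/-! The Künneth isomorphism `kunneth` identifies H^⋆(A × B) with H^⋆(A) ⊗ H^⋆(B), compatibly with
Hodge groups. When G(A × B) is all of G(A) × G(B), an irreducible V in H^⋆(A × B) is an irreducible
representation of a direct product of groups. Over ℂ it is therefore an external tensor product S ⊗
W (`IsIrreducible.exists_equiv_tensor`), and S and W can be found inside H^⋆(A) and H^⋆(B)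
(`exists_equiv_tensor_of_isIrreducible`).

Domination of A and B replaces S and W by isomorphic S' in Hⁿ(X) and W' in Hᵐ(Y), containing nonzero
forms ω and η of types (n,0) and (m,0). The image of S' ⊗ W' in H^{n+m}(X × Y) is the required
module: it contains the external product of ω and η, which is nonzero of type (n+m,0).

The delicate point is equivariance. It is required under G((A × B) × (X × Y)), while the hypotheses
give it under G(A × X) and G(B × Y). Permuting factors is an isomorphism of abelian varieties, so it
preserves Hodge groups; hence each element of the large group yields elements of the two small ones
with the same blocks (`exists_hodgeGroup_prod_of_prod_prod`). -/

open scoped TensorProduct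

/-! ### Exterior algebra of a direct sum. -/

namespace ExteriorAlgebra

section CommRing

variable {R : Type*} [CommRing R]
  {M N M' N' : Type*} [AddCommGroup M] [Module R M] [AddCommGroup N] [Module R N]
  [AddCommGroup M'] [Module R M'] [AddCommGroup N'] [Module R N']

variable (R M N) in
/-- The multiplication map `⋀ M ⊗ ⋀ N → ⋀ (M × N)`. -/
def tensorToProd : ExteriorAlgebra R M ⊗[R] ExteriorAlgebra R N →ₗ[R]
    ExteriorAlgebra R (M × N) :=
  TensorProduct.lift ((LinearMap.mul R (ExteriorAlgebra R (M × N))).compl₁₂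
    (map (LinearMap.inl R M N)).toLinearMap (map (LinearMap.inr R M N)).toLinearMap)

@[simp]
theorem tensorToProd_tmul (a : ExteriorAlgebra R M) (b : ExteriorAlgebra R N) :
    tensorToProd R M N (a ⊗ₜ b) =
      map (LinearMap.inl R M N) a * map (LinearMap.inr R M N) b := rfl

/-- An exterior algebra is the Clifford algebra of the zero form, and the Clifford algebra of an
orthogonal sum is the graded tensor product of the Clifford algebras. The graded tensor product has
the same underlying module as the ordinary one, so its signs do not matter for bijectivity. -/
theorem tensorToProd_bijective : Function.Bijective (tensorToProd R M N) := by
  have h0 : (0 : QuadraticForm R M).prod (0 : QuadraticForm R N) = 0 := by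
    ext x; simp
  let e := CliffordAlgebra.prodEquiv (0 : QuadraticForm R M) (0 : QuadraticForm R N)
  -- The orthogonal sum of two zero forms equals the zero form only propositionally, so the identity
  -- of M × N is used as an isometry between the two.
  let i : (0 : QuadraticForm R M).prod (0 : QuadraticForm R N) →qᵢ
      (0 : QuadraticForm R (M × N)) :=
    { LinearMap.id with map_app' := fun x => by simp }
  have hi : Function.Bijective (CliffordAlgebra.map i) :=
    (CliffordAlgebra.equivOfIsometry
      ({ LinearEquiv.refl R (M × N) with map_app' := fun x => by simp } :
        ((0 : QuadraticForm R M).prod (0 : QuadraticForm R N)).IsometryEquiv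
          (0 : QuadraticForm R (M × N)))).bijective
  have hl : (CliffordAlgebra.map i).comp (CliffordAlgebra.map (QuadraticMap.Isometry.inl _ _)) =
      map (LinearMap.inl R M N) := by
    ext m
    simp [i, map]
  have hr : (CliffordAlgebra.map i).comp (CliffordAlgebra.map (QuadraticMap.Isometry.inr _ _)) =
      map (LinearMap.inr R M N) := by
    ext m
    simp [i, map]
  have : tensorToProd R M N = (CliffordAlgebra.map i).toLinearMap ∘ₗ
      e.symm.toAlgHom.toLinearMap ∘ₗ
      (GradedTensorProduct.of R (CliffordAlgebra.evenOdd (0 : QuadraticForm R M))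
        (CliffordAlgebra.evenOdd (0 : QuadraticForm R N))).toLinearMap := by
    apply TensorProduct.ext'
    intro a b
    have h : e.symm (GradedTensorProduct.tmul R a b) =
        CliffordAlgebra.map (QuadraticMap.Isometry.inl _ _) a *
          CliffordAlgebra.map (QuadraticMap.Isometry.inr _ _) b := by
      rw [CliffordAlgebra.prodEquiv_symm_apply, CliffordAlgebra.toProd,
        GradedTensorProduct.lift_tmul]
    rw [tensorToProd_tmul, ← hl, ← hr, AlgHom.comp_apply, AlgHom.comp_apply, ← map_mul, ← h]
    rfl
  rw [this]
  exact hi.comp (e.symm.bijective.comp (LinearEquiv.bijective _))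

theorem map_prodMap_tensorToProd (f : M →ₗ[R] M') (g : N →ₗ[R] N')
    (x : ExteriorAlgebra R M ⊗[R] ExteriorAlgebra R N) :
    map (f.prodMap g) (tensorToProd R M N x) =
      tensorToProd R M' N' (TensorProduct.map (map f).toLinearMap (map g).toLinearMap x) := by
  induction x with
  | zero => simp
  | add x y hx hy => simp only [map_add, hx, hy]
  | tmul a b =>
    have h1 := DFunLike.congr_fun (map_comp_map (LinearMap.inl R M N) (f.prodMap g)) a
    have h2 := DFunLike.congr_fun (map_comp_map (LinearMap.inr R M N) (f.prodMap g)) b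
    have h3 := DFunLike.congr_fun (map_comp_map f (LinearMap.inl R M' N')) a
    have h4 := DFunLike.congr_fun (map_comp_map g (LinearMap.inr R M' N')) b
    have e1 : f.prodMap g ∘ₗ LinearMap.inl R M N = LinearMap.inl R M' N' ∘ₗ f := by
      ext <;> simp
    have e2 : f.prodMap g ∘ₗ LinearMap.inr R M N = LinearMap.inr R M' N' ∘ₗ g := by
      ext <;> simp
    rw [e1, ← h3] at h1
    rw [e2, ← h4] at h2
    simp only [AlgHom.comp_apply] at h1 h2
    simp [h1, h2]

/-- Both Hⁿ and the (n,0)-forms are n-th powers of a subspace in degree one, so this one statement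
serves for both. -/
theorem map_mem_map_ι_pow (f : M →ₗ[R] M') {p : Submodule R M} {q : Submodule R M'}
    (hpq : p ≤ q.comap f) {n : ℕ} {a : ExteriorAlgebra R M} (ha : a ∈ p.map (ι R) ^ n) :
    map f a ∈ q.map (ι R) ^ n := by
  have h : map f a ∈ (p.map (ι R) ^ n).map (map f).toLinearMap := ⟨a, ha, rfl⟩
  rw [Submodule.map_pow] at h
  refine pow_le_pow_left' (M := Submodule R (ExteriorAlgebra R M')) ?_ n h
  rintro _ ⟨_, ⟨x, hx, rfl⟩, rfl⟩
  exact ⟨f x, hpq hx, (map_apply_ι f x).symm⟩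

end CommRing

/-- Supplies the finite dimension needed for minimal invariant subspaces and for Schur's lemma. -/
instance finiteDimensional {K V : Type*} [Field K] [AddCommGroup V] [Module K V]
    [FiniteDimensional K V] : FiniteDimensional K (ExteriorAlgebra K V) :=
  (Module.Basis.ExteriorAlgebra (Module.finBasis K V)).finiteDimensional_of_finite

end ExteriorAlgebra

/-! ### Irreducible representations and Schur's lemma. -/

namespace Representation

variable {k G H : Type*} [Field k] [Group G] [Group H]
  {V : Type*} [AddCommGroup V] [Module k V]
  {W : Type*} [AddCommGroup W] [Module k W]

/-- Irreducibility in terms of invariant submodules. -/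
theorem isIrreducible_iff_forall_submodule (ρ : Representation k G V) :
    ρ.IsIrreducible ↔ Nontrivial V ∧
      ∀ p : Submodule k V, (∀ g, ∀ v ∈ p, ρ g v ∈ p) → p = ⊥ ∨ p = ⊤ := by
  constructor
  · intro h
    refine ⟨?_, fun p hp => ?_⟩
    · by_contra hV
      rw [not_nontrivial_iff_subsingleton] at hV
      have : (⊥ : Subrepresentation ρ) = ⊤ :=
        Subrepresentation.toSubmodule_injective (Subsingleton.elim _ _)
      exact bot_ne_top this
    · rcases h.eq_bot_or_eq_top ⟨p, fun g v hv => hp g v hv⟩ with h | h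
      · exact Or.inl (congrArg Subrepresentation.toSubmodule h)
      · exact Or.inr (congrArg Subrepresentation.toSubmodule h)
  · rintro ⟨hV, h⟩
    refine { exists_pair_ne := ⟨⊥, ⊤, fun e => ?_⟩, eq_bot_or_eq_top := fun p => ?_ }
    · exact bot_ne_top (α := Submodule k V) (congrArg Subrepresentation.toSubmodule e)
    · rcases h p.toSubmodule fun g v hv => p.apply_mem_toSubmodule g hv with h | h
      · exact Or.inl (Subrepresentation.toSubmodule_injective h)
      · exact Or.inr (Subrepresentation.toSubmodule_injective h)

/-- Irreducibility only depends on the image of the group. -/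
theorem IsIrreducible.comp_of_surjective {ρ : Representation k G V} (hρ : ρ.IsIrreducible)
    {f : H →* G} (hf : Function.Surjective f) :
    IsIrreducible (ρ.comp f : Representation k H V) := by
  rw [isIrreducible_iff_forall_submodule] at hρ ⊢
  refine ⟨hρ.1, fun p hp => hρ.2 p fun g v hv => ?_⟩
  obtain ⟨h, rfl⟩ := hf g
  exact hp h v hv

/-- Irreducibility is invariant under equivariant linear equivalences. -/
theorem IsIrreducible.of_linearEquiv {ρ : Representation k G V} (hρ : ρ.IsIrreducible)
    {σ : Representation k G W} (e : V ≃ₗ[k] W) (he : ∀ g v, e (ρ g v) = σ g (e v)) :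
    σ.IsIrreducible := by
  rw [isIrreducible_iff_forall_submodule] at hρ ⊢
  obtain ⟨hV, h⟩ := hρ
  refine ⟨e.symm.toEquiv.nontrivial, fun p hp => ?_⟩
  have hp' := h (p.comap (e : V →ₗ[k] W)) fun g v hv => by
    rw [Submodule.mem_comap] at hv ⊢
    have := hp g _ hv
    rwa [LinearEquiv.coe_coe, ← he] at this
  rcases hp' with h0 | h0
  · left
    rw [eq_bot_iff]
    intro w hw
    have : e.symm w ∈ p.comap (e : V →ₗ[k] W) := by simpa using hw
    rw [h0, Submodule.mem_bot] at this
    simpa using this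
  · right
    rw [eq_top_iff]
    intro w _
    have : e.symm w ∈ p.comap (e : V →ₗ[k] W) := h0 ▸ Submodule.mem_top
    simpa using this

/-- A nonzero finite-dimensional representation contains an irreducible one. -/
theorem exists_isIrreducible_subrepresentation [FiniteDimensional k V] [Nontrivial V]
    (ρ : Representation k G V) :
    ∃ S : Subrepresentation ρ, S.toRepresentation.IsIrreducible := by
  obtain ⟨p, ⟨hp0, hp⟩, hmin⟩ := wellFounded_lt.has_min
    {p : Submodule k V | p ≠ ⊥ ∧ ∀ g, ∀ v ∈ p, ρ g v ∈ p} ⟨⊤, top_ne_bot, by simp⟩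
  refine ⟨⟨p, fun g v hv => hp g v hv⟩, ?_⟩
  rw [isIrreducible_iff_forall_submodule]
  refine ⟨Submodule.nontrivial_iff_ne_bot.2 hp0, fun q hq => ?_⟩
  by_cases hq0 : q = ⊥
  · exact Or.inl hq0
  right
  -- Viewed inside V, a nonzero invariant q competes with p, so minimality forces equality.
  have hle : q.map p.subtype ≤ p := Submodule.map_subtype_le p q
  have hnlt := hmin (q.map p.subtype) ⟨fun h => hq0
      (Submodule.map_injective_of_injective p.injective_subtype (by rw [h, Submodule.map_bot])), by
      rintro g _ ⟨v, hv, rfl⟩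
      exact ⟨_, hq g v hv, rfl⟩⟩
  have heq : q.map p.subtype = p := hle.eq_of_not_lt hnlt
  apply Submodule.map_injective_of_injective p.injective_subtype
  rw [heq, Submodule.map_top, Submodule.range_subtype]

/-- A nonzero equivariant map out of an irreducible representation is injective. -/
theorem IsIrreducible.injective_of_ne_zero {ρ : Representation k G V} (hρ : ρ.IsIrreducible)
    {σ : Representation k G W} (f : V →ₗ[k] W) (hf : ∀ g v, f (ρ g v) = σ g (f v))
    (h0 : f ≠ 0) : Function.Injective f := by
  rw [isIrreducible_iff_forall_submodule] at hρ
  rw [← LinearMap.ker_eq_bot]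
  refine (hρ.2 (LinearMap.ker f) fun g v hv => ?_).resolve_right fun h => h0 ?_
  · rw [LinearMap.mem_ker] at hv ⊢
    rw [hf, hv, map_zero]
  · exact LinearMap.ker_eq_top.1 h

/-- A finite linearly independent family of equivariant maps out of an irreducible
representation has independent images, over an algebraically closed field. -/
theorem IsIrreducible.eq_zero_of_sum_apply_eq_zero [IsAlgClosed k] [FiniteDimensional k V]
    {ρ : Representation k G V} (hρ : ρ.IsIrreducible) {σ : Representation k G W} :
    ∀ {n : ℕ} (f : Fin n → IntertwiningMap ρ σ), LinearIndependent k f →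
      ∀ s : Fin n → V, ∑ i, f i (s i) = 0 → s = 0 := by
  intro n
  induction n with
  | zero => intro f _ s _; exact Subsingleton.elim _ _
  | succ n ih =>
    intro f hf s hs
    have hf' : LinearIndependent k fun i : Fin n => f i.succ :=
      hf.comp _ (Fin.succ_injective n)
    have ih' := ih _ hf'
    -- The last n maps assemble into F, which is injective by induction and equivariant for the
    -- diagonal action.
    let F : (Fin n → V) →ₗ[k] W := ∑ i, (f i.succ).toLinearMap ∘ₗ LinearMap.proj i
    have hF : ∀ t, F t = ∑ i, f i.succ (t i) := fun t => by simp [F]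
    have hFinj : Function.Injective F := by
      rw [injective_iff_map_eq_zero]
      intro t ht
      exact ih' t (by rw [← hF, ht])
    have hFG : ∀ g t, F (fun i => ρ g (t i)) = σ g (F t) := by
      intro g t
      rw [hF, hF, map_sum]
      exact Finset.sum_congr rfl fun i _ => IntertwiningMap.isIntertwining _ _ (f i.succ) g (t i)
    have hρ' := (isIrreducible_iff_forall_submodule ρ).1 hρ
    -- The vectors that `f 0` sends into the range of F form an invariant subspace: it is 0 or V.
    -- The relation `hs` puts `s 0` in it, which settles the first case.
    rcases hρ'.2 ((LinearMap.range F).comap (f 0).toLinearMap) (by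
      rintro g v ⟨t, ht⟩
      refine ⟨fun i => ρ g (t i), ?_⟩
      rw [hFG, ht]
      exact (IntertwiningMap.isIntertwining _ _ (f 0) g v).symm) with h | h
    · rw [Fin.sum_univ_succ] at hs
      have h0 : s 0 = 0 := by
        rw [← Submodule.mem_bot k, ← h]
        refine ⟨fun i => - s i.succ, ?_⟩
        rw [hF]
        simp only [map_neg, Finset.sum_neg_distrib]
        exact (eq_neg_of_add_eq_zero_left hs).symm
      rw [h0, map_zero, zero_add] at hs
      have := ih' (fun i => s i.succ) hs
      funext i
      refine Fin.cases h0 (fun j => ?_) i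
      exact congrFun this j
    -- Now `f 0` factors as F ∘ c. Each component of c is an endomorphism of ρ, hence a scalar by
    -- Schur, so `f 0` is a combination of the other maps, against linear independence.
    · exfalso
      let e := LinearEquiv.ofInjective F hFinj
      have hmem : ∀ v, f 0 v ∈ LinearMap.range F := fun v => by
        have : v ∈ (LinearMap.range F).comap (f 0).toLinearMap := h ▸ Submodule.mem_top
        exact this
      let c : V →ₗ[k] (Fin n → V) :=
        e.symm.toLinearMap ∘ₗ (f 0).toLinearMap.codRestrict (LinearMap.range F) hmem
      have hc : ∀ v, F (c v) = f 0 v := fun v =>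
        congrArg Subtype.val (e.apply_symm_apply ⟨f 0 v, hmem v⟩)
      have hcG : ∀ i g v, c (ρ g v) i = ρ g (c v i) := by
        intro i g v
        have : c (ρ g v) = fun i => ρ g (c v i) := by
          apply hFinj
          rw [hc, hFG, hc]
          exact IntertwiningMap.isIntertwining _ _ (f 0) g v
        exact congrFun this i
      let C : Fin n → IntertwiningMap ρ ρ := fun i =>
        ⟨LinearMap.proj i ∘ₗ c, fun g => LinearMap.ext fun v => hcG i g v⟩
      have := hρ
      choose a ha using fun i =>
        (IsIrreducible.algebraMap_intertwiningMap_bijective_of_isAlgClosed (ρ := ρ)).2 (C i)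
      have hca : ∀ v i, c v i = a i • v := fun v i =>
        (DFunLike.congr_fun (ha i) v).symm
      have hlin : f 0 = ∑ i, a i • f i.succ := by
        apply IntertwiningMap.ext
        apply LinearMap.ext
        intro v
        rw [IntertwiningMap.toLinearMap_sum, LinearMap.sum_apply]
        change f 0 v = _
        rw [← hc, hF]
        refine Finset.sum_congr rfl fun i _ => ?_
        rw [hca, map_smul]
        rfl
      have := (linearIndependent_finSucc.1 hf).2
      apply this
      rw [hlin]
      exact Submodule.sum_mem _ fun i _ =>
        Submodule.smul_mem _ _ (Submodule.subset_span ⟨i, rfl⟩)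

end Representation

/-! ### Tensor products and irreducible representations of a product of groups. -/

/-- Pure tensors of nonzero vectors are nonzero. -/
theorem TensorProduct.tmul_ne_zero_of_field {k V W : Type*} [Field k] [AddCommGroup V]
    [Module k V] [AddCommGroup W] [Module k W] {v : V} {w : W} (hv : v ≠ 0) (hw : w ≠ 0) :
    v ⊗ₜ[k] w ≠ 0 := by
  intro h
  rw [Ne, ← Module.forall_dual_apply_eq_zero_iff k] at hv hw
  push Not at hv hw
  obtain ⟨f, hf⟩ := hv
  obtain ⟨g, hg⟩ := hw
  have := congrArg (LinearMap.mul' k k ∘ₗ TensorProduct.map f g) h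
  rw [map_zero] at this
  exact mul_ne_zero hf hg this

/-- A tensor product of linear equivalences intertwines tensor products of endomorphisms that
its factors intertwine. -/
theorem TensorProduct.congr_map_of_forall_apply_eq {k V V' W W' : Type*} [CommSemiring k]
    [AddCommMonoid V] [Module k V] [AddCommMonoid V'] [Module k V']
    [AddCommMonoid W] [Module k W] [AddCommMonoid W'] [Module k W']
    (e₁ : V ≃ₗ[k] V') (e₂ : W ≃ₗ[k] W') {f : V →ₗ[k] V} {f' : V' →ₗ[k] V'}
    {g : W →ₗ[k] W} {g' : W' →ₗ[k] W'} (h₁ : ∀ v, e₁ (f v) = f' (e₁ v))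
    (h₂ : ∀ w, e₂ (g w) = g' (e₂ w)) (x : V ⊗[k] W) :
    TensorProduct.congr e₁ e₂ (TensorProduct.map f g x) =
      TensorProduct.map f' g' (TensorProduct.congr e₁ e₂ x) := by
  induction x with
  | zero => simp
  | add x y hx hy => simp only [map_add, hx, hy]
  | tmul a b => simp [h₁, h₂]

namespace Representation

variable {k G H : Type*} [Field k] [Group G] [Group H]
  {V M N S : Type*} [AddCommGroup V] [Module k V] [AddCommGroup M] [Module k M]
  [AddCommGroup N] [Module k N] [AddCommGroup S] [Module k S]

/-- For a representation `τ` of `G × H`, the group `H` acts on `G`-equivariant maps into `τ`. -/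
def homOfProd (σ : Representation k G S) (τ : Representation k (G × H) V) :
    Representation k H (IntertwiningMap σ (τ.comp (MonoidHom.inl G H) : Representation k G V)) where
  toFun h :=
    { toFun := fun f => ⟨τ (1, h) ∘ₗ f.toLinearMap, fun g => LinearMap.ext fun v => by
        have h1 : f (σ g v) = τ (g, 1) (f v) := IntertwiningMap.isIntertwining _ _ f g v
        change τ (1, h) (f (σ g v)) = τ (g, 1) (τ (1, h) (f v))
        rw [h1, ← Module.End.mul_apply, ← Module.End.mul_apply, ← map_mul, ← map_mul]
        simp⟩
      map_add' := fun f f' => IntertwiningMap.ext (LinearMap.ext fun v =>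
        (τ (1, h)).map_add (f v) (f' v))
      map_smul' := fun c f => IntertwiningMap.ext (LinearMap.ext fun v =>
        (τ (1, h)).map_smul c (f v)) }
  map_one' := LinearMap.ext fun f => IntertwiningMap.ext (LinearMap.ext fun v => by
    change τ 1 (f v) = f v
    simp)
  map_mul' h h' := LinearMap.ext fun f => IntertwiningMap.ext (LinearMap.ext fun v => by
    change τ (1, h * h') (f v) = τ (1, h) (τ (1, h') (f v))
    rw [← Module.End.mul_apply, ← map_mul]
    simp)

/-- Evaluation `S ⊗ W → V` is injective for a space `W` of equivariant maps `S → V` out of an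
irreducible representation. -/
theorem IsIrreducible.lift_injective [IsAlgClosed k] [FiniteDimensional k S]
    [FiniteDimensional k V] {σ : Representation k G S} (hσ : σ.IsIrreducible)
    {τ : Representation k G V} (W : Submodule k (IntertwiningMap σ τ)) :
    Function.Injective (TensorProduct.lift
      ((IntertwiningMap.toLinearMapl σ τ ∘ₗ W.subtype).flip)) := by
  rw [injective_iff_map_eq_zero]
  intro x hx
  -- Along a basis of W, an element of the kernel becomes a relation ∑ bᵢ(sᵢ) = 0 between
  -- independent equivariant maps.
  let b := Module.finBasis k W
  let E := TensorProduct.equivFinsuppOfBasisRight (M := S) b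
  have hxE : x = ∑ i, E x i ⊗ₜ b i := by
    conv_lhs => rw [← E.symm_apply_apply x]
    rw [TensorProduct.equivFinsuppOfBasisRight_symm_apply, Finsupp.sum_fintype _ _ (by simp)]
  have hli : LinearIndependent k fun i => (b i : IntertwiningMap σ τ) :=
    b.linearIndependent.map' W.subtype (Submodule.ker_subtype W)
  have := hσ.eq_zero_of_sum_apply_eq_zero _ hli (fun i => E x i) (by
    rw [← hx]
    conv_rhs => rw [hxE]
    rw [map_sum]
    rfl)
  rw [hxE]
  exact Finset.sum_eq_zero fun i _ => by rw [congrFun this i]; simp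

/-- Over an algebraically closed field, a finite-dimensional irreducible representation of a
product of two groups is an external tensor product. -/
theorem IsIrreducible.exists_equiv_tensor [IsAlgClosed k] [FiniteDimensional k V]
    {τ : Representation k (G × H) V} (hτ : τ.IsIrreducible) :
    ∃ S : Subrepresentation (τ.comp (MonoidHom.inl G H) : Representation k G V),
      S.toRepresentation.IsIrreducible ∧
      ∃ W : Subrepresentation (homOfProd S.toRepresentation τ), W.toRepresentation.IsIrreducible ∧
        ∃ e : (S.toSubmodule ⊗[k] W.toSubmodule) ≃ₗ[k] V, ∀ g h x,
          e (TensorProduct.map (S.toRepresentation g) (W.toRepresentation h) x) =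
            τ (g, h) (e x) := by
  have hτ' := (isIrreducible_iff_forall_submodule τ).1 hτ
  have := hτ'.1
  obtain ⟨S, hS⟩ := exists_isIrreducible_subrepresentation
    (τ.comp (MonoidHom.inl G H) : Representation k G V)
  have hS' := (isIrreducible_iff_forall_submodule _).1 hS
  -- The inclusion shows that Hom_G(S, V) is nonzero, so that it contains an irreducible W.
  let incl : IntertwiningMap S.toRepresentation
      (τ.comp (MonoidHom.inl G H) : Representation k G V) :=
    ⟨S.toSubmodule.subtype, fun g => rfl⟩
  have : Nontrivial (IntertwiningMap S.toRepresentation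
      (τ.comp (MonoidHom.inl G H) : Representation k G V)) := by
    have := hS'.1
    obtain ⟨s, hs⟩ := exists_ne (0 : S.toSubmodule)
    exact ⟨incl, 0, fun h => hs (Subtype.ext (DFunLike.congr_fun h s))⟩
  -- Evaluation on S ⊗ W is injective for any W, and irreducibility of V makes it onto as soon as W
  -- is nonzero. Taking W irreducible, rather than all of Hom_G(S, V), makes its irreducibility
  -- immediate.
  obtain ⟨W, hW⟩ := exists_isIrreducible_subrepresentation (homOfProd S.toRepresentation τ)
  refine ⟨S, hS, W, hW, ?_⟩
  let F := TensorProduct.lift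
      ((IntertwiningMap.toLinearMapl _ _ ∘ₗ W.toSubmodule.subtype).flip)
  have hF : ∀ g h x, F (TensorProduct.map (S.toRepresentation g) (W.toRepresentation h) x) =
      τ (g, h) (F x) := by
    intro g h x
    induction x with
    | zero => simp
    | add x y hx hy => simp only [map_add, hx, hy]
    | tmul s w =>
      have h1 : w.1 (S.toRepresentation g s) = τ (g, 1) (w.1 s) :=
        IntertwiningMap.isIntertwining _ _ w.1 g s
      change τ (1, h) (w.1 (S.toRepresentation g s)) = τ (g, h) (w.1 s)
      rw [h1, ← Module.End.mul_apply, ← map_mul]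
      simp
  have hinj : Function.Injective F := hS.lift_injective W.toSubmodule
  have hsurj : Function.Surjective F := by
    rw [← LinearMap.range_eq_top]
    refine (hτ'.2 (LinearMap.range F) ?_).resolve_left fun h0 => ?_
    · rintro ⟨g, h⟩ _ ⟨x, rfl⟩
      exact ⟨_, hF g h x⟩
    · have h1 := hS'.1
      have h2 := ((isIrreducible_iff_forall_submodule _).1 hW).1
      have h3 : Nontrivial (S.toSubmodule ⊗[k] W.toSubmodule) := inferInstance
      obtain ⟨x, hx⟩ := exists_ne (0 : S.toSubmodule ⊗[k] W.toSubmodule)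
      refine hx (hinj ?_)
      have : F x ∈ LinearMap.range F := ⟨x, rfl⟩
      rw [h0, Submodule.mem_bot] at this
      rw [this, map_zero]
  exact ⟨LinearEquiv.ofBijective F ⟨hinj, hsurj⟩, hF⟩

/-- An irreducible representation mapping nontrivially to `M ⊗ N`, with the group acting on the
first factor only, is isomorphic to a subrepresentation of `M`. -/
theorem IsIrreducible.exists_equiv_subrepresentation {σ : Representation k G S}
    (hσ : σ.IsIrreducible) {ρ : Representation k G M} (f : S →ₗ[k] M ⊗[k] N) (hf0 : f ≠ 0)
    (hf : ∀ g s, f (σ g s) = (ρ g).rTensor N (f s)) :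
    ∃ S' : Subrepresentation ρ, S'.toRepresentation.IsIrreducible ∧
      ∃ e : S'.toSubmodule ≃ₗ[k] S, ∀ g s, e (S'.toRepresentation g s) = σ g (e s) := by
  classical
  -- A basis of N splits M ⊗ N into copies of M. The coordinates of f are equivariant; one is
  -- nonzero, hence injective by irreducibility.
  let b := Module.Free.chooseBasis k N
  let E := TensorProduct.equivFinsuppOfBasisRight (M := M) b
  let c := fun i => Finsupp.lapply i ∘ₗ E.toLinearMap ∘ₗ f
  have hE : ∀ i (T : M →ₗ[k] M) x, E (T.rTensor N x) i = T (E x i) := by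
    intro i T x
    induction x with
    | zero => simp
    | add x y hx hy => simp only [map_add, Finsupp.add_apply, hx, hy]
    | tmul m n => simp [E]
  have hc : ∀ i g s, c i (σ g s) = ρ g (c i s) := by
    intro i g s
    change E (f (σ g s)) i = ρ g (E (f s) i)
    rw [hf, hE]
  obtain ⟨i, hi⟩ : ∃ i, c i ≠ 0 := by
    by_contra! h
    refine hf0 (LinearMap.ext fun s => E.injective (Finsupp.ext fun i => ?_))
    rw [LinearMap.zero_apply, map_zero]
    exact DFunLike.congr_fun (h i) s
  have hinj := hσ.injective_of_ne_zero (c i) (hc i) hi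
  let S' : Subrepresentation ρ := ⟨LinearMap.range (c i), by
    rintro g _ ⟨s, rfl⟩
    exact ⟨σ g s, hc i g s⟩⟩
  let e : S ≃ₗ[k] S'.toSubmodule := LinearEquiv.ofInjective (c i) hinj
  have he : ∀ g s, e (σ g s) = S'.toRepresentation g (e s) := fun g s => Subtype.ext (hc i g s)
  refine ⟨S', hσ.of_linearEquiv e he, e.symm, fun g s => ?_⟩
  rw [LinearEquiv.symm_apply_eq, he, LinearEquiv.apply_symm_apply]

/-- An irreducible representation of `G × H` contained in `M ⊗ N` is the external tensor product
of irreducible subrepresentations of `M` and `N`. -/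
theorem IsIrreducible.exists_equiv_tensor_subrepresentation [IsAlgClosed k]
    [FiniteDimensional k V] {τ : Representation k (G × H) V} (hτ : τ.IsIrreducible)
    {ρ : Representation k G M} {σ : Representation k H N} (j : V →ₗ[k] M ⊗[k] N)
    (hj : Function.Injective j)
    (hjG : ∀ g h v, j (τ (g, h) v) = TensorProduct.map (ρ g) (σ h) (j v)) :
    ∃ S : Subrepresentation ρ, S.toRepresentation.IsIrreducible ∧
      ∃ W : Subrepresentation σ, W.toRepresentation.IsIrreducible ∧
        ∃ e : (S.toSubmodule ⊗[k] W.toSubmodule) ≃ₗ[k] V, ∀ g h x,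
          e (TensorProduct.map (S.toRepresentation g) (W.toRepresentation h) x) =
            τ (g, h) (e x) := by
  obtain ⟨S, hS, W, hW, e, he⟩ := hτ.exists_equiv_tensor
  have := ((isIrreducible_iff_forall_submodule _).1 hS).1
  have := ((isIrreducible_iff_forall_submodule _).1 hW).1
  obtain ⟨s, hs⟩ := exists_ne (0 : S.toSubmodule)
  obtain ⟨w, hw⟩ := exists_ne (0 : W.toSubmodule)
  have hne : j (e (s ⊗ₜ w)) ≠ 0 := by
    rw [Ne, map_eq_zero_iff j hj, map_eq_zero_iff e e.injective]
    exact TensorProduct.tmul_ne_zero_of_field hs hw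
  -- With w fixed, s ↦ j (e (s ⊗ w)) is a nonzero G-map to M ⊗ N, in which N only counts
  -- multiplicity. This moves S from V into M.
  obtain ⟨S', hS', eS, heS⟩ := hS.exists_equiv_subrepresentation (ρ := ρ)
    (j ∘ₗ e.toLinearMap ∘ₗ (TensorProduct.mk k _ _).flip w)
    (fun h => hne (DFunLike.congr_fun h s)) (fun g x => by
      have := congrArg j (he g 1 (x ⊗ₜ w))
      rw [hjG, map_one, map_one, TensorProduct.map_tmul] at this
      exact this)
  -- The same with s fixed; `comm` brings N to the front.
  obtain ⟨W', hW', eW, heW⟩ := hW.exists_equiv_subrepresentation (ρ := σ)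
    ((_root_.TensorProduct.comm k M N).toLinearMap ∘ₗ j ∘ₗ e.toLinearMap ∘ₗ TensorProduct.mk k _ _ s)
    (fun h => hne ((_root_.TensorProduct.comm k M N).injective
      ((DFunLike.congr_fun h w).trans (map_zero _).symm))) (fun h x => by
      have := congrArg j (he 1 h (s ⊗ₜ x))
      rw [hjG, map_one, map_one, TensorProduct.map_tmul] at this
      change _root_.TensorProduct.comm k M N (j (e (s ⊗ₜ _))) = _
      rw [Module.End.one_apply] at this
      rw [this]
      change _ = (σ h).rTensor M (_root_.TensorProduct.comm k M N (j (e (s ⊗ₜ x))))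
      exact (TensorProduct.map_comm _ _ _).symm)
  refine ⟨S', hS', W', hW', (TensorProduct.congr eS eW).trans e, fun g h x => ?_⟩
  rw [LinearEquiv.trans_apply, LinearEquiv.trans_apply, ← he]
  exact congrArg e (TensorProduct.congr_map_of_forall_apply_eq eS eW (heS g) (heW h) x)

end Representation

/-! ### Hodge groups under isomorphisms and regrouping of factors. -/

noncomputable section

namespace ComplexAbelianVariety

/-- Pushing forward invariant 1-forms along an isomorphism of Lie algebras. -/
def H1Congr {P Q : ComplexAbelianVariety.{u}} (e : P.E ≃ₗ[ℂ] Q.E) : P.H1 ≃ₗ[ℂ] Q.H1 where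
  toFun φ := φ ∘ₗ (e.symm.restrictScalars ℝ).toLinearMap
  invFun φ := φ ∘ₗ (e.restrictScalars ℝ).toLinearMap
  map_add' _ _ := rfl
  map_smul' _ _ := rfl
  left_inv φ := by ext x; simp
  right_inv φ := by ext x; simp

/-- Conjugation of `GL(H¹)` by an isomorphism of Lie algebras. -/
def GL1Congr {P Q : ComplexAbelianVariety.{u}} (e : P.E ≃ₗ[ℂ] Q.E) : P.GL1 →* Q.GL1 where
  toFun g := (H1Congr e).symm.trans (g.trans (H1Congr e))
  map_one' := LinearEquiv.ext fun φ => (H1Congr e).apply_symm_apply φ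
  map_mul' g h := LinearEquiv.ext fun φ => by
    change H1Congr e (g (h ((H1Congr e).symm φ))) =
      H1Congr e (g ((H1Congr e).symm (H1Congr e (h ((H1Congr e).symm φ)))))
    rw [LinearEquiv.symm_apply_apply]

/-- The Hodge group is functorial under isomorphisms of abelian varieties. -/
theorem GL1Congr_mem_hodgeGroup {P Q : ComplexAbelianVariety.{u}} (e : P.E ≃ₗ[ℂ] Q.E)
    (he : ∀ x, e x ∈ Q.lattice ↔ x ∈ P.lattice) {g : P.GL1} (hg : g ∈ P.hodgeGroup) :
    GL1Congr e g ∈ Q.hodgeGroup := by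
  refine Subgroup.mem_sInf.2 ?_
  rintro K ⟨⟨p, hp⟩, hK⟩
  -- It suffices that the preimage of K is one of the groups whose intersection is the Hodge group
  -- of P. Rational classes and lattice vectors of Q pull back to those of P, so renaming variables
  -- turns equations for K into equations for its preimage.
  refine Subgroup.mem_sInf.1 hg (K.comap (GL1Congr e)) ⟨?_, ?_⟩
  · have hr : ∀ φ : Q.rationalClasses, (H1Congr e).symm φ ∈ P.rationalClasses :=
      fun φ x hx => φ.2 (e x) ((he x).2 hx)
    have hl : ∀ x : Q.lattice, e.symm x ∈ P.lattice := fun x => by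
      rw [← he, e.apply_symm_apply]
      exact x.2
    let f : Q.rationalClasses × Q.lattice → P.rationalClasses × P.lattice :=
      fun i => (⟨_, hr i.1⟩, ⟨_, hl i.2⟩)
    refine ⟨MvPolynomial.rename f '' p, ?_⟩
    ext k
    change GL1Congr e k ∈ (K : Set Q.GL1) ↔ _
    rw [hp, Set.mem_ofPred_eq, Set.mem_ofPred_eq, Set.forall_mem_image]
    refine forall₂_congr fun q _ => ?_
    rw [MvPolynomial.aeval_rename]
    rfl
  · intro z
    -- Complex linearity of e makes it commute with multiplication by z.
    have : GL1Congr e (P.hodgeCocharacter z) = Q.hodgeCocharacter z := by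
      apply LinearEquiv.ext
      intro φ
      apply LinearMap.ext
      intro x
      change φ (e ((z : ℂ) • e.symm x)) = φ ((z : ℂ) • x)
      rw [map_smul, e.apply_symm_apply]
    change GL1Congr e (P.hodgeCocharacter z) ∈ K
    rw [this]
    exact hK z

variable (A B X Y : ComplexAbelianVariety.{u})

theorem hodgeGroup_apply_kunneth1 (g : (A.prod B).hodgeGroup) (φ : A.H1) (ψ : B.H1) :
    (g : (A.prod B).GL1) (kunneth1 A B (φ, ψ)) =
      kunneth1 A B ((hodgeGroupFst A B g : A.GL1) φ, (hodgeGroupSnd A B g : B.GL1) ψ) := by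
  conv_lhs => rw [← blockDiag_fst_snd A B g]
  exact blockDiag_apply A B _ φ ψ

/-- The isomorphism `(A × B) × (X × Y) ≃ (A × X) × (B × Y)` on Lie algebras. -/
def prodProdProdComm : ((A.prod B).prod (X.prod Y)).E ≃ₗ[ℂ] ((A.prod X).prod (B.prod Y)).E :=
  LinearEquiv.prodProdProdComm ℂ A.E B.E X.E Y.E

theorem prodProdProdComm_mem_lattice (x : ((A.prod B).prod (X.prod Y)).E) :
    prodProdProdComm A B X Y x ∈ ((A.prod X).prod (B.prod Y)).lattice ↔
      x ∈ ((A.prod B).prod (X.prod Y)).lattice :=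
  and_and_and_comm

theorem H1Congr_prodProdProdComm_kunneth1 (φ : A.H1) (ψ : B.H1) (φ' : X.H1) (ψ' : Y.H1) :
    H1Congr (prodProdProdComm A B X Y) (kunneth1 (A.prod B) (X.prod Y)
        (kunneth1 A B (φ, ψ), kunneth1 X Y (φ', ψ'))) =
      kunneth1 (A.prod X) (B.prod Y) (kunneth1 A X (φ, φ'), kunneth1 B Y (ψ, ψ')) := by
  apply LinearMap.ext
  rintro ⟨⟨a, x⟩, ⟨b, y⟩⟩
  exact add_add_add_comm (φ a) (ψ b) (φ' x) (ψ' y)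

/-- The Hodge group of `(A × B) × (X × Y)` projects to those of `A × X` and `B × Y`. -/
theorem exists_hodgeGroup_prod_of_prod_prod (g : ((A.prod B).prod (X.prod Y)).hodgeGroup) :
    ∃ (h : (A.prod X).hodgeGroup) (k : (B.prod Y).hodgeGroup),
      hodgeGroupFst A X h = hodgeGroupFst A B (hodgeGroupFst _ _ g) ∧
      hodgeGroupSnd A X h = hodgeGroupFst X Y (hodgeGroupSnd _ _ g) ∧
      hodgeGroupFst B Y k = hodgeGroupSnd A B (hodgeGroupFst _ _ g) ∧
      hodgeGroupSnd B Y k = hodgeGroupSnd X Y (hodgeGroupSnd _ _ g) := by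
  let c := H1Congr (prodProdProdComm A B X Y)
  -- After regrouping, g lies in the Hodge group of (A × X) × (B × Y), whose two projections are the
  -- required h and k.
  let g' : ((A.prod X).prod (B.prod Y)).hodgeGroup := ⟨GL1Congr _ g,
    GL1Congr_mem_hodgeGroup _ (prodProdProdComm_mem_lattice A B X Y) g.2⟩
  have key : ∀ φ ψ φ' ψ', (g' : GL1 _) (c (kunneth1 _ _ (kunneth1 A B (φ, ψ),
      kunneth1 X Y (φ', ψ')))) = c ((g : GL1 _) (kunneth1 _ _ (kunneth1 A B (φ, ψ),
      kunneth1 X Y (φ', ψ')))) := by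
    intro φ ψ φ' ψ'
    change c ((g : GL1 _) (c.symm (c _))) = _
    rw [c.symm_apply_apply]
  simp only [c, H1Congr_prodProdProdComm_kunneth1, hodgeGroup_apply_kunneth1,
    EmbeddingLike.apply_eq_iff_eq, Prod.mk.injEq] at key
  refine ⟨hodgeGroupFst _ _ g', hodgeGroupSnd _ _ g', ?_, ?_, ?_, ?_⟩
  -- A class supported on one of the four summands isolates one block.
  · exact Subtype.ext (LinearEquiv.ext fun φ => (key φ 0 0 0).1.1)
  · exact Subtype.ext (LinearEquiv.ext fun φ => (key 0 0 φ 0).1.2)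
  · exact Subtype.ext (LinearEquiv.ext fun φ => (key 0 φ 0 0).2.1)
  · exact Subtype.ext (LinearEquiv.ext fun φ => (key 0 0 0 φ).2.2)

/-! ### The Künneth isomorphism, its equivariance and external products. -/

/-- The Künneth isomorphism `H^⋆(A, ℂ) ⊗ H^⋆(B, ℂ) ≃ H^⋆(A × B, ℂ)`. -/
def kunneth : (A.Cohomology ⊗[ℂ] B.Cohomology) ≃ₗ[ℂ] (A.prod B).Cohomology :=
  LinearEquiv.ofBijective
    ((ExteriorAlgebra.map (kunneth1 A B).toLinearMap).toLinearMap ∘ₗ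
      ExteriorAlgebra.tensorToProd ℂ A.H1 B.H1)
    ((show Function.Bijective (ExteriorAlgebra.map (kunneth1 A B).toLinearMap) from
      ⟨ExteriorAlgebra.map_injective ⟨(kunneth1 A B).symm.toLinearMap, by ext <;> simp⟩,
        ExteriorAlgebra.map_surjective_iff.2 (kunneth1 A B).surjective⟩).comp
      ExteriorAlgebra.tensorToProd_bijective)

theorem kunneth_apply (x : A.Cohomology ⊗[ℂ] B.Cohomology) :
    kunneth A B x = ExteriorAlgebra.map (kunneth1 A B).toLinearMap
      (ExteriorAlgebra.tensorToProd ℂ A.H1 B.H1 x) := rfl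

/-- On H¹ the element g is block diagonal; functoriality of the exterior algebra carries this to all
degrees. -/
theorem cohomologyRep_kunneth (g : (A.prod B).hodgeGroup) (x : A.Cohomology ⊗[ℂ] B.Cohomology) :
    (A.prod B).cohomologyRep g (kunneth A B x) =
      kunneth A B (TensorProduct.map (A.cohomologyRep (hodgeGroupFst A B g))
        (B.cohomologyRep (hodgeGroupSnd A B g)) x) := by
  have h : (g : (A.prod B).GL1).toLinearMap ∘ₗ (kunneth1 A B).toLinearMap =
      (kunneth1 A B).toLinearMap ∘ₗ
        ((hodgeGroupFst A B g : A.GL1).toLinearMap.prodMap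
          (hodgeGroupSnd A B g : B.GL1).toLinearMap) :=
    LinearMap.ext fun x : A.H1 × B.H1 => hodgeGroup_apply_kunneth1 A B g x.1 x.2
  change ExteriorAlgebra.map _ (ExteriorAlgebra.map _ _) = ExteriorAlgebra.map _
    (ExteriorAlgebra.tensorToProd ℂ A.H1 B.H1
      (TensorProduct.map (ExteriorAlgebra.map _).toLinearMap
        (ExteriorAlgebra.map _).toLinearMap x))
  rw [← ExteriorAlgebra.map_prodMap_tensorToProd, ← AlgHom.comp_apply, ← AlgHom.comp_apply,
    ExteriorAlgebra.map_comp_map, ExteriorAlgebra.map_comp_map, h]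

/-- Used with the full H¹ for degrees and with H^{1,0} for holomorphic forms. -/
theorem kunneth_tmul_mem_map_ι_pow {p : Submodule ℂ A.H1} {q : Submodule ℂ B.H1}
    {r : Submodule ℂ (A.prod B).H1} (h : ∀ φ ∈ p, ∀ ψ ∈ q, kunneth1 A B (φ, ψ) ∈ r) {n m : ℕ}
    {a : A.Cohomology} {b : B.Cohomology} (ha : a ∈ p.map (ExteriorAlgebra.ι ℂ) ^ n)
    (hb : b ∈ q.map (ExteriorAlgebra.ι ℂ) ^ m) :
    kunneth A B (a ⊗ₜ b) ∈ r.map (ExteriorAlgebra.ι ℂ) ^ (n + m) := by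
  rw [kunneth_apply, ExteriorAlgebra.tensorToProd_tmul, map_mul, pow_add]
  refine Submodule.mul_mem_mul ?_ ?_
  · rw [← AlgHom.comp_apply, ExteriorAlgebra.map_comp_map]
    exact ExteriorAlgebra.map_mem_map_ι_pow
      ((kunneth1 A B).toLinearMap ∘ₗ LinearMap.inl ℂ A.H1 B.H1) (fun φ hφ => h φ hφ 0 q.zero_mem) ha
  · rw [← AlgHom.comp_apply, ExteriorAlgebra.map_comp_map]
    exact ExteriorAlgebra.map_mem_map_ι_pow
      ((kunneth1 A B).toLinearMap ∘ₗ LinearMap.inr ℂ A.H1 B.H1) (fun ψ hψ => h 0 p.zero_mem ψ hψ) hb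

theorem kunneth_tmul_mem_H {n m : ℕ} {a : A.Cohomology} {b : B.Cohomology} (ha : a ∈ A.H n)
    (hb : b ∈ B.H m) : kunneth A B (a ⊗ₜ b) ∈ (A.prod B).H (n + m) := by
  have hH : ∀ (P : ComplexAbelianVariety.{u}) (i : ℕ),
      P.H i = (⊤ : Submodule ℂ P.H1).map (ExteriorAlgebra.ι ℂ) ^ i :=
    fun P i => by rw [Submodule.map_top]
  rw [hH] at ha hb ⊢
  exact kunneth_tmul_mem_map_ι_pow A B (fun _ _ _ _ => Submodule.mem_top) ha hb

theorem kunneth_tmul_mem_formsN0 {n m : ℕ} {a : A.Cohomology} {b : B.Cohomology}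
    (ha : a ∈ A.formsN0 n) (hb : b ∈ B.formsN0 m) :
    kunneth A B (a ⊗ₜ b) ∈ (A.prod B).formsN0 (n + m) := by
  refine kunneth_tmul_mem_map_ι_pow A B ?_ ha hb
  rintro φ hφ ψ hψ ⟨x, y⟩
  change φ (Complex.I • x) + ψ (Complex.I • y) = Complex.I * (φ x + ψ y)
  rw [hφ x, hψ y, mul_add]

/-- The external product of subrepresentations of `H^⋆(A, ℂ)` and `H^⋆(B, ℂ)`. -/
def kunnethSubrepresentation (S : Subrepresentation A.cohomologyRep)
    (W : Subrepresentation B.cohomologyRep) : Subrepresentation (A.prod B).cohomologyRep where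
  toSubmodule := LinearMap.range ((kunneth A B).toLinearMap ∘ₗ
    TensorProduct.map S.toSubmodule.subtype W.toSubmodule.subtype)
  apply_mem_toSubmodule := by
    rintro g _ ⟨x, rfl⟩
    refine ⟨TensorProduct.map (S.toRepresentation (hodgeGroupFst A B g))
      (W.toRepresentation (hodgeGroupSnd A B g)) x, ?_⟩
    rw [LinearMap.comp_apply, LinearMap.comp_apply, LinearEquiv.coe_coe, cohomologyRep_kunneth]
    congr 1
    induction x with
    | zero => simp
    | add x y hx hy => simp only [map_add, hx, hy]
    | tmul s w => rfl

/-- The external product of subrepresentations is their tensor product. -/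
def kunnethSubrepresentationEquiv (S : Subrepresentation A.cohomologyRep)
    (W : Subrepresentation B.cohomologyRep) :
    (S.toSubmodule ⊗[ℂ] W.toSubmodule) ≃ₗ[ℂ] (kunnethSubrepresentation A B S W).toSubmodule :=
  LinearEquiv.ofInjective _ ((kunneth A B).injective.comp
    (TensorProduct.map_injective_of_flat_flat _ _ S.toSubmodule.injective_subtype
      W.toSubmodule.injective_subtype))

theorem kunnethSubrepresentationEquiv_map (S : Subrepresentation A.cohomologyRep)
    (W : Subrepresentation B.cohomologyRep) (g : (A.prod B).hodgeGroup)
    (x : S.toSubmodule ⊗[ℂ] W.toSubmodule) :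
    kunnethSubrepresentationEquiv A B S W (TensorProduct.map
        (S.toRepresentation (hodgeGroupFst A B g)) (W.toRepresentation (hodgeGroupSnd A B g)) x) =
      (kunnethSubrepresentation A B S W).toRepresentation g
        (kunnethSubrepresentationEquiv A B S W x) := by
  apply Subtype.ext
  change kunneth A B _ = (A.prod B).cohomologyRep g (kunneth A B _)
  rw [cohomologyRep_kunneth]
  congr 1
  induction x with
  | zero => simp
  | add x y hx hy => simp only [map_add, hx, hy]
  | tmul s w => rfl

/-- Injectivity is block-diagonality of G(A × B); `hG` provides surjectivity. -/
theorem hodgeGroupInclusion_bijective (hG : (A.prod B).hodgeGroup = hodgeGroupProd A B) :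
    Function.Bijective (hodgeGroupInclusion A B) := by
  constructor
  · intro g h e
    apply Subtype.ext
    rw [← blockDiag_fst_snd A B g, ← blockDiag_fst_snd A B h]
    change blockDiag A B ((hodgeGroupInclusion A B g).1, (hodgeGroupInclusion A B g).2) =
      blockDiag A B ((hodgeGroupInclusion A B h).1, (hodgeGroupInclusion A B h).2)
    rw [e]
  · rintro ⟨a, b⟩
    have hmem : blockDiag A B (a, b) ∈ (A.prod B).hodgeGroup := by
      rw [hG]
      exact ⟨(a, b), ⟨a.2, b.2⟩, rfl⟩
    refine ⟨⟨_, hmem⟩, ?_⟩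
    have := blockDiag_injective A B (blockDiag_fst_snd A B ⟨_, hmem⟩)
    exact Prod.ext (Subtype.ext (congrArg Prod.fst this)) (Subtype.ext (congrArg Prod.snd this))

/-- If `G(A × B) = G(A) × G(B)`, an irreducible submodule of `H^⋆(A × B, ℂ)` is an external tensor
product of irreducible submodules of `H^⋆(A, ℂ)` and `H^⋆(B, ℂ)`. -/
theorem exists_equiv_tensor_of_isIrreducible (hG : (A.prod B).hodgeGroup = hodgeGroupProd A B)
    (V : Subrepresentation (A.prod B).cohomologyRep) (hV : V.toRepresentation.IsIrreducible) :
    ∃ S : Subrepresentation A.cohomologyRep, S.toRepresentation.IsIrreducible ∧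
      ∃ W : Subrepresentation B.cohomologyRep, W.toRepresentation.IsIrreducible ∧
        ∃ e : (S.toSubmodule ⊗[ℂ] W.toSubmodule) ≃ₗ[ℂ] V.toSubmodule, ∀ g x,
          e (TensorProduct.map (S.toRepresentation (hodgeGroupFst A B g))
            (W.toRepresentation (hodgeGroupSnd A B g)) x) = V.toRepresentation g (e x) := by
  -- Through i, V becomes a representation of the abstract product G(A) × G(B), embedded by the
  -- inverse Künneth map in H^⋆(A) ⊗ H^⋆(B).
  let i := MulEquiv.ofBijective _ (hodgeGroupInclusion_bijective A B hG)
  have hτ := hV.comp_of_surjective (f := i.symm.toMonoidHom) i.symm.surjective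
  obtain ⟨S, hS, W, hW, e, he⟩ := hτ.exists_equiv_tensor_subrepresentation
    (ρ := A.cohomologyRep) (σ := B.cohomologyRep)
    ((kunneth A B).symm.toLinearMap ∘ₗ V.toSubmodule.subtype)
    ((kunneth A B).symm.injective.comp V.toSubmodule.injective_subtype) (fun g h v => by
      obtain ⟨q, hq⟩ := i.surjective (g, h)
      have h1 : hodgeGroupFst A B q = g := congrArg Prod.fst hq
      have h2 : hodgeGroupSnd A B q = h := congrArg Prod.snd hq
      have h3 : i.symm (g, h) = q := by rw [← hq, i.symm_apply_apply]
      change (kunneth A B).symm ((A.prod B).cohomologyRep (i.symm (g, h)) v) =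
        TensorProduct.map _ _ ((kunneth A B).symm v)
      rw [LinearEquiv.symm_apply_eq, ← h1, ← h2, ← cohomologyRep_kunneth,
        LinearEquiv.apply_symm_apply, h1, h2, h3])
  refine ⟨S, hS, W, hW, e, fun g x => ?_⟩
  rw [he]
  change V.toRepresentation (i.symm (i g)) (e x) = _
  rw [i.symm_apply_apply]

end ComplexAbelianVariety

end

/-! ### The proposition. -/

theorem proposition3p3 (A B : ComplexAbelianVariety.{u})
    (𝒜 ℬ : Set ComplexAbelianVariety.{u})
    (hG : (A.prod B).hodgeGroup = ComplexAbelianVariety.hodgeGroupProd A B)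
    (hA : A.IsCDominated 𝒜) (hB : B.IsCDominated ℬ) :
    (A.prod B).IsCDominated {Z | ∃ X ∈ 𝒜, ∃ Y ∈ ℬ, Z = X.prod Y} := by
  intro V hV
  obtain ⟨S, hS, W, hW, e, he⟩ := A.exists_equiv_tensor_of_isIrreducible B hG V hV
  obtain ⟨X, hX, n, S', hS'n, ⟨eS⟩, ω, hωS, hω0, hω⟩ := hA S hS
  obtain ⟨Y, hY, m, W', hW'm, ⟨eW⟩, η, hηW, hη0, hη⟩ := hB W hW
  let F := ComplexAbelianVariety.kunnethSubrepresentationEquiv X Y S' W'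
  refine ⟨X.prod Y, ⟨X, hX, Y, hY, rfl⟩, n + m,
    ComplexAbelianVariety.kunnethSubrepresentation X Y S' W', ?_, ⟨?_⟩,
    X.kunneth Y (ω ⊗ₜ η), ?_, ?_, X.kunneth_tmul_mem_formsN0 Y hω hη⟩
  · rintro _ ⟨x, rfl⟩
    induction x with
    | zero => simp
    | add x y hx hy => rw [map_add]; exact add_mem hx hy
    | tmul s w => exact X.kunneth_tmul_mem_H Y (hS'n s.2) (hW'm w.2)
  · refine Representation.Equiv.mk
      -- The isomorphism is the chain V ≃ S ⊗ W ≃ S' ⊗ W' ≃ V'.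
      (e.symm.trans ((TensorProduct.congr eS.toLinearEquiv eW.toLinearEquiv).trans F))
      fun g => LinearMap.ext fun v => ?_
    obtain ⟨t, rfl⟩ := e.surjective v
    -- `eS` and `eW` are equivariant under G(A × X) and G(B × Y) respectively; h and k carry the
    -- four blocks of g into those groups.
    obtain ⟨h, k, h1, h2, h3, h4⟩ :=
      ComplexAbelianVariety.exists_hodgeGroup_prod_of_prod_prod A B X Y g
    have hSG : ∀ s, eS (S.toRepresentation (A.hodgeGroupFst X h) s) =
        S'.toRepresentation (A.hodgeGroupSnd X h) (eS s) :=
      fun s => Representation.IntertwiningMap.isIntertwining _ _ eS.toIntertwiningMap h s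
    have hWG : ∀ w, eW (W.toRepresentation (B.hodgeGroupFst Y k) w) =
        W'.toRepresentation (B.hodgeGroupSnd Y k) (eW w) :=
      fun w => Representation.IntertwiningMap.isIntertwining _ _ eW.toIntertwiningMap k w
    have hF := ComplexAbelianVariety.kunnethSubrepresentationEquiv_map X Y S' W'
      ((A.prod B).hodgeGroupSnd (X.prod Y) g)
      (TensorProduct.congr eS.toLinearEquiv eW.toLinearEquiv t)
    have hE := he ((A.prod B).hodgeGroupFst (X.prod Y) g) t
    rw [← h2, ← h4] at hF
    rw [← h1, ← h3] at hE
    have hC := TensorProduct.congr_map_of_forall_apply_eq eS.toLinearEquiv eW.toLinearEquiv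
      hSG hWG t
    simp only [LinearMap.comp_apply, LinearEquiv.coe_coe, LinearEquiv.trans_apply,
      LinearEquiv.symm_apply_apply]
    refine Eq.trans ?_ hF
    refine congrArg F (Eq.trans (congrArg _ ?_) hC)
    rw [LinearEquiv.symm_apply_eq]
    exact hE.symm
  · exact ⟨⟨ω, hωS⟩ ⊗ₜ ⟨η, hηW⟩, rfl⟩
  · rw [Ne, LinearEquiv.map_eq_zero_iff]
    exact TensorProduct.tmul_ne_zero_of_field hω0 hη0
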